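/- Let $K\ge 0$, let $\mu_1\ge\mu_2\ge\dots\ge\mu_K>0$ be the service rates and $c_1,\dots,c_K\in\{0,1,2,\dots\}$ the capacities of $K$ server chains, and let $\lambda>0$ be the arrival rate. Consider the continuous-time Markov chain $(\mathbf Z(t))_{t\ge 0}$ of the system state under the policy Join-the-Fastest-Free-Chain (JFFC), where $Z_0(t)$ is the number of queued jobs and $Z_l(t)$ the number of ongoing jobs on chain $l$. Its state space is $$\mathcal Z=\{z: z_0=0,\ 0\le z_l\le c_l\ \forall l\in\{1,\dots,K\}\}\ \cup\ \{(n,c_1,\dots,c_K): n\ge 1\},$$ and its transition rates $q(z,z')$, $z\ne z'$, are $$q(z,z')=\begin{cases}\lambda & \text{if } z \text{ turns into } z' \text{ upon an arrival},\\ z_l\mu_l & \text{if } z'_0=z_0=0,\ z'_l=z_l-1\ \text{and}\ z'_{l'}=z_{l'}\ \text{for all } l'\ne l\ (\text{for some } l\in\{1,\dots,K\}),\\ \sum_{l=1}^K c_l\mu_l & \text{if } z'_0=z_0-1\ \text{and}\ z'_l=z_l=c_l\ \text{for all } l\in\{1,\dots,K\},\\ 0 & \text{otherwise.}\end{cases}$$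 Here, upon an arrival, $z$ turns into the state with $z_0$ increased by $1$ if $z_l=c_l$ for all $l\in\{1,\dots,K\}$, and otherwise into the state with $z_{l^*}$ increased by $1$, where $l^*=\min\{l: z_l<c_l\}$ is the fastest chain with a free place. If $\lambda<\sum_{l=1}^K c_l\mu_l$, then $(\mathbf Z(t))_{t\ge 0}$ is ergodic, that is, irreducible (for all $x,y\in\mathcal Z$ there is $t\ge 0$ with $P_x(\mathbf Z(t)=y)>0$) and positive recurrent (started in any state $x\in\mathcal Z$, the mean time until the first return to $x$ after the first jump is finite). -/

import Mathlib

open MeasureTheory ProbabilityTheory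
open scoped NNReal ENNReal

noncomputable section

/-- The transition rates of a continuous-time Markov chain on a state space `S`: the numbers
`q x y` for `x ≠ y` (the diagonal is set to `0`), with a finite total rate out of each state. -/
structure TransitionRates (S : Type*) where
  /-- the rate from `x` to `y` -/
  q : S → S → ℝ≥0
  q_self : ∀ x, q x x = 0
  summable_q : ∀ x, Summable (q x)

namespace TransitionRates

section Generic

variable {S : Type*} (R : TransitionRates S)

/-- The total rate out of `x`. -/
def exitRate (x : S) : ℝ≥0 := ∑' y, R.q x y

theorem tsum_coe (x : S) : ∑' y, (R.q x y : ℝ≥0∞) = (R.exitRate x : ℝ≥0∞) :=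
  (ENNReal.coe_tsum (R.summable_q x)).symm

open Classical in
/-- The law of the state entered at the next jump out of `x`: it is `y` with probability
`q x y / exitRate x`. (An absorbing state is followed by itself.) -/
def jumpLaw (x : S) : PMF S :=
  if h : R.exitRate x = 0 then PMF.pure x
  else PMF.normalize (fun y => (R.q x y : ℝ≥0∞))
    (by rw [R.tsum_coe]; exact_mod_cast h)
    (by rw [R.tsum_coe]; exact ENNReal.coe_ne_top)

open Classical in
/-- The law of the time spent in `x` before the next jump: exponential with rate `exitRate x`,
and infinite if `x` is absorbing. -/
def holdLaw (x : S) : Measure ℝ≥0∞ :=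
  if R.exitRate x = 0 then Measure.dirac ⊤
  else (expMeasure (R.exitRate x : ℝ)).map ENNReal.ofReal

instance (x : S) : IsProbabilityMeasure (R.holdLaw x) := by
  unfold holdLaw
  split_ifs with h
  · infer_instance
  · have hp : (0 : ℝ) < (R.exitRate x : ℝ) := by
      exact_mod_cast pos_iff_ne_zero.mpr h
    have := isProbabilityMeasure_expMeasure hp
    exact Measure.isProbabilityMeasure_map ENNReal.measurable_ofReal.aemeasurable

variable [MeasurableSpace S] [MeasurableSingletonClass S] [Countable S]

/-- The transition kernel of the jump chain. -/
def jumpKernel : Kernel S S := Kernel.ofFunOfCountable fun x => (R.jumpLaw x).toMeasure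

/-- The kernel of the holding times. -/
def holdKernel : Kernel S ℝ≥0∞ := Kernel.ofFunOfCountable R.holdLaw

instance : IsMarkovKernel R.jumpKernel :=
  ⟨fun x => by change IsProbabilityMeasure (R.jumpLaw x).toMeasure; infer_instance⟩

instance : IsMarkovKernel R.holdKernel :=
  ⟨fun x => by change IsProbabilityMeasure (R.holdLaw x); infer_instance⟩

/-- From the state `x`, draw the next state of the jump chain, and then the time that will be
spent in that next state. -/
def stepKernel : Kernel S (S × ℝ≥0∞) :=
  R.jumpKernel.compProd (R.holdKernel.prodMkLeft S)

instance : IsMarkovKernel R.stepKernel := by unfold stepKernel; infer_instance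

/-- The same step, given the whole past of visited states and holding times. -/
def pastKernel (n : ℕ) :
    Kernel ((_i : Finset.Iic n) → S × ℝ≥0∞) (S × ℝ≥0∞) :=
  R.stepKernel.comap (fun h => (h ⟨n, Finset.mem_Iic.mpr le_rfl⟩).1)
    (measurable_fst.comp (measurable_pi_apply _))

instance (n : ℕ) : IsMarkovKernel (R.pastKernel n) := by unfold pastKernel; infer_instance

/-- The law `P_x` of the chain started in `x`, on the space of sequences `(Y_n, S_n)` of the
successively visited states `Y_n` and the times `S_n` spent there. Under `P_x` the states form a
Markov chain started in `x` with transition probabilities `q y z / exitRate y`, and given the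
states the holding times are independent, `S_n` being exponential with rate `exitRate Y_n`. -/
def law (x : S) : Measure (ℕ → S × ℝ≥0∞) :=
  Kernel.trajMeasure (X := fun _ => S × ℝ≥0∞)
    ((Measure.dirac x).compProd R.holdKernel) R.pastKernel

instance (x : S) : IsProbabilityMeasure (R.law x) := by unfold law; infer_instance

end Generic

section Path

variable {S : Type*}

/-- The time of the `n`-th jump (`0` for `n = 0`). -/
def jumpTime (ω : ℕ → S × ℝ≥0∞) (n : ℕ) : ℝ≥0∞ := ∑ i ∈ Finset.range n, (ω i).2

open Classical in
/-- The state at time `t`: the state `Y_n` with `jumpTime n ≤ t < jumpTime (n + 1)`, and `none`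
if infinitely many jumps have taken place up to time `t` (explosion). -/
def stateAt (ω : ℕ → S × ℝ≥0∞) (t : ℝ≥0) : Option S :=
  if h : ∃ n, (t : ℝ≥0∞) < jumpTime ω (n + 1) then some (ω (Nat.find h)).1 else none

/-- The first passage time to `x` after the first jump,
`inf {t ≥ jumpTime 1 : the state at time t is x}`, infinite if there is no such `t`. -/
def returnTime (x : S) (ω : ℕ → S × ℝ≥0∞) : ℝ≥0∞ :=
  ⨅ (t : ℝ≥0) (_ : jumpTime ω 1 ≤ (t : ℝ≥0∞) ∧ stateAt ω t = some x), (t : ℝ≥0∞)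

end Path

section Ergodicity

variable {S : Type*} [MeasurableSpace S] [MeasurableSingletonClass S] [Countable S]
  (R : TransitionRates S)

/-- Every state can be reached from every state:
for all `x`, `y` there is a time `t` with `P_x (Z t = y) > 0`. -/
def Irreducible : Prop :=
  ∀ x y : S, ∃ t : ℝ≥0, 0 < R.law x {ω | stateAt ω t = some y}

/-- The state `x` is absorbing or the chain started in `x` has a finite mean return time
to `x`. -/
def PositiveRecurrent (x : S) : Prop :=
  R.exitRate x = 0 ∨ ∫⁻ ω, returnTime x ω ∂(R.law x) < ⊤

/-- Ergodicity of a continuous-time Markov chain: it is irreducible and all its states are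
positive recurrent. -/
def Ergodic : Prop := R.Irreducible ∧ ∀ x, R.PositiveRecurrent x

end Ergodicity

end TransitionRates

namespace JFFC

variable {K : ℕ}

/-- The states `z = (z_0, z_1, …, z_K)`: `z.1.1 = z_0` is the number of queued jobs and
`z.1.2 l` the number of ongoing jobs on the chain `l`. Either the queue is empty, or all the
chains are fully occupied. -/
def State (c : Fin K → ℕ) : Type :=
  {z : ℕ × (Fin K → ℕ) // (z.1 = 0 ∧ ∀ l, z.2 l ≤ c l) ∨ (0 < z.1 ∧ z.2 = c)}

variable {c : Fin K → ℕ}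

/-- The number of queued jobs. -/
def State.queue (z : State c) : ℕ := z.1.1

/-- The number of ongoing jobs on each chain. -/
def State.jobs (z : State c) : Fin K → ℕ := z.1.2

instance : Countable (State c) := by unfold State; infer_instance

instance : MeasurableSpace (State c) := ⊤

instance : MeasurableSingletonClass (State c) := ⟨fun _ => trivial⟩

theorem State.ext {z w : State c} (h₁ : z.queue = w.queue) (h₂ : z.jobs = w.jobs) : z = w :=
  Subtype.ext (Prod.ext h₁ h₂)

/-- Upon an arrival `z` turns into `z'`: the new job is queued if all the chains are fully
occupied, and otherwise joins the first chain `l` that has a free place. -/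
def IsArrival (z z' : State c) : Prop :=
  (z.jobs = c ∧ z'.queue = z.queue + 1 ∧ z'.jobs = z.jobs) ∨
  ∃ l, (z.jobs l < c l ∧ ∀ l' < l, ¬ z.jobs l' < c l') ∧
    z'.jobs l = z.jobs l + 1 ∧ (∀ l' ≠ l, z'.jobs l' = z.jobs l') ∧ z'.queue = z.queue

/-- With an empty queue, a job on chain `l` is completed and `z` turns into `z'`. -/
def IsDeparture (l : Fin K) (z z' : State c) : Prop :=
  z.queue = 0 ∧ z'.queue = 0 ∧ z'.jobs l + 1 = z.jobs l ∧ ∀ l' ≠ l, z'.jobs l' = z.jobs l'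

/-- With a nonempty queue, some job is completed and the first queued job takes its place. -/
def IsQueueDeparture (z z' : State c) : Prop :=
  z'.queue + 1 = z.queue ∧ z.jobs = c ∧ z'.jobs = c

open Classical in
/-- The transition rate from `z` to `z'`. For given `z` and `z'` at most one of the conditions
(the arrival, the departures from the chains `l`, the departure with a nonempty queue) holds,
so at most one summand differs from `0`. -/
def rate (lam : ℝ≥0) (mu : Fin K → ℝ≥0) (z z' : State c) : ℝ≥0 :=
  (if IsArrival z z' then lam else 0) +
  (∑ l, if IsDeparture l z z' then (z.jobs l : ℝ≥0) * mu l else 0) +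
  (if IsQueueDeparture z z' then ∑ l, (c l : ℝ≥0) * mu l else 0)

theorem rate_self (lam : ℝ≥0) (mu : Fin K → ℝ≥0) (z : State c) : rate lam mu z z = 0 := by
  have h₁ : ¬ IsArrival z z := by
    rintro (⟨-, h, -⟩ | ⟨l, -, h, -⟩) <;> omega
  have h₂ : ∀ l, ¬ IsDeparture l z z := by
    rintro l ⟨-, -, h, -⟩; omega
  have h₃ : ¬ IsQueueDeparture z z := by
    rintro ⟨h, -⟩; omega
  simp [rate, h₁, h₂, h₃]

theorem summable_ite {α : Type*} (p : α → Prop) [DecidablePred p] (a : ℝ≥0)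
    (h : ∀ x y, p x → p y → x = y) : Summable fun x => if p x then a else 0 := by
  apply summable_of_hasFiniteSupport
  refine Set.Subsingleton.finite fun x hx y hy => h x y ?_ ?_
  · by_contra hp; simp [hp] at hx
  · by_contra hp; simp [hp] at hy

theorem IsArrival.unique {z x y : State c} (hx : IsArrival z x) (hy : IsArrival z y) :
    x = y := by
  rcases hx with ⟨h, hq, hj⟩ | ⟨l, ⟨hl, hl'⟩, h₁, h₂, h₃⟩ <;>
    rcases hy with ⟨g, gq, gj⟩ | ⟨m, ⟨gl, gl'⟩, g₁, g₂, g₃⟩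
  · exact State.ext (hq.trans gq.symm) (hj.trans gj.symm)
  · rw [h] at gl; omega
  · rw [g] at hl; omega
  · obtain rfl : l = m := by
      rcases lt_trichotomy l m with k | k | k
      · exact absurd hl (gl' l k)
      · exact k
      · exact absurd gl (hl' m k)
    refine State.ext (h₃.trans g₃.symm) (funext fun i => ?_)
    by_cases hi : i = l
    · subst hi; rw [h₁, g₁]
    · rw [h₂ i hi, g₂ i hi]

theorem IsDeparture.unique {l : Fin K} {z x y : State c} (hx : IsDeparture l z x)
    (hy : IsDeparture l z y) : x = y := by
  obtain ⟨-, h₁, h₂, h₃⟩ := hx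
  obtain ⟨-, g₁, g₂, g₃⟩ := hy
  refine State.ext (h₁.trans g₁.symm) (funext fun i => ?_)
  by_cases hi : i = l
  · subst hi; omega
  · rw [h₃ i hi, g₃ i hi]

theorem IsQueueDeparture.unique {z x y : State c} (hx : IsQueueDeparture z x)
    (hy : IsQueueDeparture z y) : x = y := by
  obtain ⟨h₁, -, h₂⟩ := hx
  obtain ⟨g₁, -, g₂⟩ := hy
  exact State.ext (by omega) (h₂.trans g₂.symm)

theorem summable_rate (lam : ℝ≥0) (mu : Fin K → ℝ≥0) (z : State c) :
    Summable (rate lam mu z) := by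
  classical
  unfold rate
  refine Summable.add (Summable.add ?_ (summable_sum fun l _ => ?_)) ?_
  · exact summable_ite _ _ fun _ _ => IsArrival.unique
  · exact summable_ite _ _ fun _ _ => IsDeparture.unique
  · exact summable_ite _ _ fun _ _ => IsQueueDeparture.unique

/-- The transition rates of the system state under Join-the-Fastest-Free-Chain with arrival
rate `lam`, service rates `mu` (in descending order) and capacities `c`. -/
def rates (lam : ℝ≥0) (mu : Fin K → ℝ≥0) (c : Fin K → ℕ) : TransitionRates (State c) where
  q := rate lam mu
  q_self := rate_self lam mu
  summable_q := summable_rate lam mu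

end JFFC

end

/-!
Irreducibility. From any state the system fills up (arrivals occupy the free places, departures
empty the queue), and from the full system without a queue any state can be reached
(`JFFC.reflTransGen_full`, `JFFC.reflTransGen_of_full`). A path of positive rates from `x` to `y`
gives `P_x(Y_n = y) > 0` for some `n`, and since the holding times are almost surely positive and
finite, the state is then `y` at some rational time (`TransitionRates.irreducible_of_reflTransGen`).

Positive recurrence. With a nonempty queue the queue length is a birth-and-death chain with drift
`λ - ∑ c_l μ_l < 0` (`JFFC.queue_drift_full_succ`), and only finitely many states have an empty
queue. This is the Foster–Lyapunov criterion (`TransitionRates.positiveRecurrent_of_lyapunov`).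

The criterion is proved without an analysis of excursions from the finite set. For a given target
state `x`, the rates being bounded away from `0` and `∞`, the bounded function `1 - ε ^ d`, with
`d` the number of steps needed to reach `x` and `ε` small, has a negative drift everywhere except
at `x` (`TransitionRates.exists_bounded_drift`). A combination of it with the queue length has a
negative drift, bounded away from `0`, outside the single state `x`. For such a function `W` a
telescoping sum (`TransitionRates.positiveRecurrent_of_drift`) bounds the mean of
`∑ n, 1{Y_1, …, Y_n ≠ x} (S_n + 1)`, where `S_n` is the holding time in `Y_n`. This sum dominates
the return time: if there is no return, it is infinite because of the terms `1`.
-/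

namespace TransitionRates

/-! ### Exponential holding times -/

theorem lintegral_ofReal_expMeasure {r : ℝ} (hr : 0 < r) :
    ∫⁻ s, ENNReal.ofReal s ∂expMeasure r = (ENNReal.ofReal r)⁻¹ := by
  -- Multiplied by `s`, the exponential density is a multiple of the gamma density of shape `2`.
  have h : ∀ s, gammaPDF 1 r s * ENNReal.ofReal s = (ENNReal.ofReal r)⁻¹ * gammaPDF 2 r s := by
    intro s
    rw [← ENNReal.ofReal_inv_of_pos hr, gammaPDF_eq, gammaPDF_eq]
    split_ifs with hs
    · rw [← ENNReal.ofReal_mul (by positivity), ← ENNReal.ofReal_mul (by positivity)]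
      congr 1
      have h2 : Real.Gamma 2 = 1 := by simp
      norm_num [h2, Real.Gamma_one]
      field_simp
    · simp
  have hm : ∀ a, Measurable (gammaPDF a r) := fun a =>
    (measurable_gammaPDFReal a r).ennreal_ofReal
  rw [expMeasure, gammaMeasure, lintegral_withDensity_eq_lintegral_mul _ (hm 1)
    ENNReal.measurable_ofReal]
  simp only [Pi.mul_apply]
  rw [lintegral_congr h, lintegral_const_mul _ (hm 2),
    lintegral_gammaPDF_eq_one two_pos hr, mul_one]

theorem expMeasure_Iic_zero {r : ℝ} (hr : 0 < r) : expMeasure r (Set.Iic 0) = 0 := by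
  have h := lintegral_exponentialPDF_eq_antiDeriv hr 0
  rw [expMeasure, gammaMeasure, withDensity_apply _ measurableSet_Iic]
  rw [if_pos le_rfl, mul_zero, neg_zero, Real.exp_zero, sub_self, ENNReal.ofReal_zero] at h
  exact h

section Generic

variable {S : Type*} (R : TransitionRates S)

/-- The mean holding time; it is infinite exactly in an absorbing state. -/
theorem lintegral_holdLaw (x : S) : ∫⁻ s, s ∂(R.holdLaw x) = (R.exitRate x : ℝ≥0∞)⁻¹ := by
  unfold holdLaw
  split_ifs with h
  · simp [h]
  · have hp : (0 : ℝ) < R.exitRate x := by exact_mod_cast pos_iff_ne_zero.mpr h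
    rw [lintegral_map measurable_id' ENNReal.measurable_ofReal]
    simpa using lintegral_ofReal_expMeasure hp

theorem holdLaw_zero (x : S) : R.holdLaw x {0} = 0 := by
  unfold holdLaw
  split_ifs with h
  · simp
  · have hp : (0 : ℝ) < R.exitRate x := by exact_mod_cast pos_iff_ne_zero.mpr h
    rw [Measure.map_apply ENNReal.measurable_ofReal (measurableSet_singleton 0)]
    convert! expMeasure_Iic_zero hp using 2
    ext s
    simp

theorem holdLaw_top {x : S} (h : R.exitRate x ≠ 0) : R.holdLaw x {⊤} = 0 := by
  rw [holdLaw, if_neg h,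
    Measure.map_apply ENNReal.measurable_ofReal (measurableSet_singleton _)]
  convert! measure_empty (μ := expMeasure (R.exitRate x : ℝ)) using 2
  ext s
  simp

theorem jumpLaw_apply {x : S} (h : R.exitRate x ≠ 0) (y : S) :
    R.jumpLaw x y = R.q x y * (R.exitRate x : ℝ≥0∞)⁻¹ := by
  rw [jumpLaw, dif_neg h, PMF.normalize_apply, R.tsum_coe]

/-! ### One step of the chain under `law` -/

variable [MeasurableSpace S] [MeasurableSingletonClass S] [Countable S]

theorem lintegral_stepKernel (z : S) {g : S × ℝ≥0∞ → ℝ≥0∞} (hg : Measurable g) :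
    ∫⁻ p, g p ∂(R.stepKernel z) = ∑' y, R.jumpLaw z y * ∫⁻ s, g (y, s) ∂(R.holdLaw y) := by
  rw [stepKernel, Kernel.lintegral_compProd _ _ _ hg, lintegral_countable']
  refine tsum_congr fun y => ?_
  rw [mul_comm]
  congr 1
  exact PMF.toMeasure_apply_singleton _ _ (measurableSet_singleton y)

/-- The Markov property: given the past up to the `n`-th jump, the next state and its holding
time are distributed according to `stepKernel` at the current state. -/
theorem lintegral_law_succ (x : S) (n : ℕ) {f : ((_i : Finset.Iic n) → S × ℝ≥0∞) → ℝ≥0∞}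
    (hf : Measurable f) {g : S × ℝ≥0∞ → ℝ≥0∞} (hg : Measurable g) :
    ∫⁻ ω, f (Preorder.frestrictLe (π := fun _ => S × ℝ≥0∞) n ω) * g (ω (n + 1)) ∂(R.law x) =
      ∫⁻ ω, f (Preorder.frestrictLe (π := fun _ => S × ℝ≥0∞) n ω) *
        ∫⁻ p, g p ∂(R.stepKernel (ω n).1) ∂(R.law x) := by
  have key := Kernel.map_frestrictLe_trajMeasure_compProd_eq_map_trajMeasure
    (X := fun _ => S × ℝ≥0∞) (κ := R.pastKernel)
    (μ₀ := (Measure.dirac x).compProd R.holdKernel) (a := n)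
  have hG : Measurable fun p : ((_i : Finset.Iic n) → S × ℝ≥0∞) × (S × ℝ≥0∞) =>
      f p.1 * g p.2 := (hf.comp measurable_fst).mul (hg.comp measurable_snd)
  have h1 := congrArg (fun m => ∫⁻ p, f p.1 * g p.2 ∂m) key
  rw [lintegral_map hG (by fun_prop), Measure.lintegral_compProd hG,
    lintegral_map hG.lintegral_kernel_prod_right' (by fun_prop)] at h1
  rw [law, ← h1]
  refine lintegral_congr fun ω => ?_
  simp only [lintegral_const_mul _ hg]
  rfl

theorem lintegral_law_zero (x : S) {g : S × ℝ≥0∞ → ℝ≥0∞} (hg : Measurable g) :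
    ∫⁻ ω, g (ω 0) ∂(R.law x) = ∫⁻ s, g (x, s) ∂(R.holdLaw x) := by
  have hm : Measurable fun h : ((_i : Finset.Iic 0) → S × ℝ≥0∞) =>
      g (h ⟨0, Finset.mem_Iic.mpr le_rfl⟩) := by fun_prop
  have h1 : ∫⁻ h, g (h ⟨0, Finset.mem_Iic.mpr le_rfl⟩) ∂((R.law x).map
      (Preorder.frestrictLe (π := fun _ => S × ℝ≥0∞) 0)) = ∫⁻ ω, g (ω 0) ∂(R.law x) := by
    rw [lintegral_map hm (by fun_prop)]
    rfl
  rw [← h1, law, Kernel.trajMeasure, Measure.map_comp _ _ (by fun_prop),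
    Kernel.traj_map_frestrictLe, Kernel.partialTraj_self, Measure.id_comp,
    lintegral_map hm (by fun_prop), Measure.lintegral_compProd]
  · rw [lintegral_dirac]
    rfl
  · exact hg

end Generic
end TransitionRates

namespace TransitionRates

/-! ### Sample paths -/

section Path

variable {S : Type*}

theorem jumpTime_mono (ω : ℕ → S × ℝ≥0∞) : Monotone (jumpTime ω) := fun _ _ h =>
  Finset.sum_le_sum_of_subset (Finset.range_mono h)

theorem stateAt_eq {ω : ℕ → S × ℝ≥0∞} {n : ℕ} {t : ℝ≥0} (h₁ : jumpTime ω n ≤ t)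
    (h₂ : (t : ℝ≥0∞) < jumpTime ω (n + 1)) : stateAt ω t = some (ω n).1 := by
  classical
  have h : ∃ n, (t : ℝ≥0∞) < jumpTime ω (n + 1) := ⟨n, h₂⟩
  have hn : Nat.find h = n := (Nat.find_eq_iff h).2
    ⟨h₂, fun m hm => not_lt.2 ((jumpTime_mono ω hm).trans h₁)⟩
  rw [stateAt, dif_pos h]
  convert! rfl
  exact hn.symm

theorem jumpTime_lt_succ {ω : ℕ → S × ℝ≥0∞} {n : ℕ} (h : jumpTime ω n ≠ ⊤)
    (h₀ : (ω n).2 ≠ 0) : jumpTime ω n < jumpTime ω (n + 1) := by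
  rw [jumpTime, jumpTime, Finset.sum_range_succ]
  exact ENNReal.lt_add_right h h₀

theorem returnTime_le_jumpTime {ω : ℕ → S × ℝ≥0∞} {n : ℕ} (hn : n ≠ 0)
    (h₀ : (ω n).2 ≠ 0) : returnTime (ω n).1 ω ≤ jumpTime ω n := by
  by_cases h : jumpTime ω n = ⊤
  · simp [h]
  lift jumpTime ω n to ℝ≥0 using h with t ht
  refine iInf₂_le t ⟨?_, ?_⟩
  · rw [ht]
    exact jumpTime_mono ω (Nat.one_le_iff_ne_zero.2 hn)
  · refine stateAt_eq ht.ge ?_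
    rw [ht]
    exact jumpTime_lt_succ (by simp [← ht]) h₀

open Classical in
/-- The indicator that none of the states `Y_1, …, Y_n` is `x`. -/
noncomputable def noVisit (x : S) (n : ℕ) (ω : ℕ → S × ℝ≥0∞) : ℝ≥0∞ :=
  ∏ j ∈ Finset.Iic n, if j ≠ 0 ∧ (ω j).1 = x then 0 else 1

theorem noVisit_zero (x : S) (ω : ℕ → S × ℝ≥0∞) : noVisit x 0 ω = 1 :=
  Finset.prod_eq_one fun j hj => by
    have : j = 0 := by simpa using hj
    simp [this]

open Classical in
theorem noVisit_succ (x : S) (n : ℕ) (ω : ℕ → S × ℝ≥0∞) :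
    noVisit x (n + 1) ω = noVisit x n ω * if (ω (n + 1)).1 = x then 0 else 1 := by
  simp only [noVisit, ← Nat.range_succ_eq_Iic]
  rw [Finset.prod_range_succ]
  simp

theorem noVisit_eq_one {x : S} {n : ℕ} {ω : ℕ → S × ℝ≥0∞}
    (h : ∀ j ≤ n, j ≠ 0 → (ω j).1 ≠ x) : noVisit x n ω = 1 :=
  Finset.prod_eq_one fun j hj => if_neg fun hj' => h j (Finset.mem_Iic.1 hj) hj'.1 hj'.2

/-- The return time is bounded by the holding times before the first return, and the sum of the
terms `S_n + 1` over these `n` is infinite if there is no return. -/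
theorem returnTime_le_tsum (x : S) {ω : ℕ → S × ℝ≥0∞} (h₀ : ∀ n, (ω n).2 ≠ 0) :
    returnTime x ω ≤ ∑' n, noVisit x n ω * ((ω n).2 + 1) := by
  classical
  by_cases h : ∃ n, n ≠ 0 ∧ (ω n).1 = x
  · have hmin : ∀ i < Nat.find h, noVisit x i ω = 1 := fun i hi =>
      noVisit_eq_one fun j hj hj0 hjx => Nat.find_min h (hj.trans_lt hi) ⟨hj0, hjx⟩
    calc returnTime x ω = returnTime (ω (Nat.find h)).1 ω := by rw [(Nat.find_spec h).2]
      _ ≤ jumpTime ω (Nat.find h) := returnTime_le_jumpTime (Nat.find_spec h).1 (h₀ _)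
      _ ≤ ∑ i ∈ Finset.range (Nat.find h), noVisit x i ω * ((ω i).2 + 1) := by
        refine Finset.sum_le_sum fun i hi => ?_
        rw [hmin i (Finset.mem_range.1 hi), one_mul]
        exact le_self_add
      _ ≤ _ := ENNReal.sum_le_tsum _
  · push Not at h
    refine le_top.trans (top_le_iff.2 ?_)
    rw [← top_le_iff, ← ENNReal.tsum_const_eq_top_of_ne_zero (α := ℕ) one_ne_zero]
    refine ENNReal.tsum_le_tsum fun n => ?_
    rw [noVisit_eq_one fun j _ hj => h j hj, one_mul]
    exact le_add_self

variable [MeasurableSpace S] [MeasurableSingletonClass S]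

theorem measurableSet_state (n : ℕ) (c : S) :
    MeasurableSet {ω : ℕ → S × ℝ≥0∞ | (ω n).1 = c} :=
  (measurable_fst.comp (measurable_pi_apply n)) (measurableSet_singleton c)

theorem measurable_noVisit (x : S) (n : ℕ) : Measurable (noVisit x n) := by
  classical
  refine Finset.measurable_prod _ fun j _ => Measurable.ite ?_ measurable_const measurable_const
  exact (MeasurableSet.const _).inter
    ((measurable_fst.comp (measurable_pi_apply j)) (measurableSet_singleton x))

end Path

section Generic

variable {S : Type*} [MeasurableSpace S] [MeasurableSingletonClass S] [Countable S]
  (R : TransitionRates S)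

theorem ae_holdingTime_ne (x : S) {a : ℝ≥0∞} (h : ∀ y, R.holdLaw y {a} = 0) :
    ∀ᵐ ω ∂(R.law x), ∀ n, (ω n).2 ≠ a := by
  have hA : MeasurableSet {p : S × ℝ≥0∞ | p.2 = a} :=
    measurable_snd (measurableSet_singleton a)
  have hg : Measurable ({p : S × ℝ≥0∞ | p.2 = a}.indicator (1 : S × ℝ≥0∞ → ℝ≥0∞)) :=
    measurable_one.indicator hA
  have hint : ∀ y, ∫⁻ s, {p : S × ℝ≥0∞ | p.2 = a}.indicator (1 : S × ℝ≥0∞ → ℝ≥0∞) (y, s)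
      ∂(R.holdLaw y) = 0 := fun y => by
    rw [← h y, ← lintegral_indicator_one (measurableSet_singleton a)]
    rfl
  refine ae_all_iff.2 fun n => ?_
  have key : ∫⁻ ω, {p : S × ℝ≥0∞ | p.2 = a}.indicator (1 : S × ℝ≥0∞ → ℝ≥0∞) (ω n)
      ∂(R.law x) = 0 := by
    cases n with
    | zero => rw [R.lintegral_law_zero x hg, hint]
    | succ n =>
      have h1 := R.lintegral_law_succ x n (f := fun _ => 1) measurable_const hg
      simp only [one_mul] at h1
      rw [h1]
      simp [R.lintegral_stepKernel _ hg, hint]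
  rw [lintegral_eq_zero_iff (by fun_prop)] at key
  filter_upwards [key] with ω hω hn
  simp [hn] at hω

/-! ### Irreducibility -/

theorem law_state_pos {x y : S} (h : Relation.ReflTransGen (fun a b => 0 < R.q a b) x y) :
    ∃ n, R.law x {ω | (ω n).1 = y} ≠ 0 := by
  induction h with
  | refl =>
    refine ⟨0, ?_⟩
    have hA : MeasurableSet {p : S × ℝ≥0∞ | p.1 = x} :=
      measurable_fst (measurableSet_singleton x)
    have h1 := R.lintegral_law_zero x (g := {p | p.1 = x}.indicator 1)
      (measurable_one.indicator hA)
    have h2 : R.law x {ω | (ω 0).1 = x} = 1 := by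
      rw [← lintegral_indicator_one (measurableSet_state 0 x)]
      refine h1.trans ?_
      simp [Set.indicator]
    simp [h2]
  | @tail a b _ hab ih =>
    obtain ⟨n, hn⟩ := ih
    refine ⟨n + 1, ?_⟩
    have hA : ∀ c : S, MeasurableSet {p : S × ℝ≥0∞ | p.1 = c} := fun c =>
      measurable_fst (measurableSet_singleton c)
    have hm : ∀ c : S, Measurable ({p : S × ℝ≥0∞ | p.1 = c}.indicator (1 : S × ℝ≥0∞ → ℝ≥0∞)) :=
      fun c => measurable_one.indicator (hA c)
    have h1 := R.lintegral_law_succ x n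
      (f := fun h => {p : S × ℝ≥0∞ | p.1 = a}.indicator 1 (h ⟨n, Finset.mem_Iic.mpr le_rfl⟩))
      ((hm a).comp (measurable_pi_apply _)) (hm b)
    have hq : R.exitRate a ≠ 0 := by
      have := (R.summable_q a).le_tsum b (fun _ _ => zero_le)
      exact (hab.trans_le this).ne'
    have hp : R.jumpLaw a b ≠ 0 := by
      rw [R.jumpLaw_apply hq]
      exact mul_ne_zero (by exact_mod_cast hab.ne') (by simp)
    have h2 : R.jumpLaw a b * R.law x {ω | (ω n).1 = a} ≤ R.law x {ω | (ω (n + 1)).1 = b} := by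
      rw [← lintegral_indicator_one (measurableSet_state (n + 1) b),
        ← lintegral_indicator_one (measurableSet_state n a), ← lintegral_const_mul _
          (measurable_one.indicator (measurableSet_state n a))]
      calc _ ≤ _ := lintegral_mono fun ω => ?_
        _ = _ := h1.symm
        _ ≤ _ := lintegral_mono fun ω => ?_
      · by_cases hω : (ω n).1 = a
        · rw [R.lintegral_stepKernel _ (hm b), hω]
          refine le_trans ?_ (mul_le_mul' le_rfl (ENNReal.le_tsum b))
          simp [Set.indicator, hω, Preorder.frestrictLe]
        · simp [Set.indicator, hω]
      · refine (mul_le_of_le_one_left' ?_).trans le_rfl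
        exact Set.indicator_apply_le' (fun _ => le_rfl) fun _ => zero_le
    intro h0
    rw [h0, nonpos_iff_eq_zero, mul_eq_zero] at h2
    exact h2.elim hp hn

/-- A chain without absorbing states is irreducible as soon as any two states are joined by a
path of positive rates. Almost surely the holding times are positive and finite, so on the event
`Y_n = y` the state is `y` at some rational time; by countability one of these times works. -/
theorem irreducible_of_reflTransGen (hexit : ∀ x, R.exitRate x ≠ 0)
    (h : ∀ x y, Relation.ReflTransGen (fun a b => 0 < R.q a b) x y) : R.Irreducible := by
  intro x y
  obtain ⟨n, hn⟩ := R.law_state_pos (h x y)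
  by_contra! hcon
  have h0 : ∀ᵐ ω ∂(R.law x), ∀ r : ℚ, stateAt ω (r : ℝ).toNNReal ≠ some y :=
    ae_all_iff.2 fun r => by
      rw [ae_iff]
      simpa using hcon (r : ℝ).toNNReal
  refine hn (measure_eq_zero_iff_ae_notMem.2 ?_)
  filter_upwards [h0, R.ae_holdingTime_ne x R.holdLaw_zero,
    R.ae_holdingTime_ne x fun y => R.holdLaw_top (hexit y)] with ω h1 h2 h3 hω
  have hfin : jumpTime ω n ≠ ⊤ := ENNReal.sum_ne_top.2 fun i _ => h3 i
  obtain ⟨r, hr0, hr1, hr2⟩ := ENNReal.lt_iff_exists_rat_btwn.1 (jumpTime_lt_succ hfin (h2 n))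
  exact h1 r ((stateAt_eq hr1.le hr2).trans (congrArg some hω))

/-! ### Positive recurrence from a drift condition -/

/-- Killing the chain upon a visit to `x`: a bound `W` on the mean of `g` over the holding time
is only needed in the other states. -/
theorem lintegral_noVisit_succ (x : S) (n : ℕ) {g : S × ℝ≥0∞ → ℝ≥0∞} (hg : Measurable g)
    {W : S → ℝ≥0∞} (hW : ∀ y ≠ x, ∫⁻ s, g (y, s) ∂(R.holdLaw y) ≤ W y) :
    ∫⁻ ω, noVisit x (n + 1) ω * g (ω (n + 1)) ∂(R.law x) ≤
      ∫⁻ ω, noVisit x n ω * ∑' y, R.jumpLaw (ω n).1 y * W y ∂(R.law x) := by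
  classical
  have hg' : Measurable fun p : S × ℝ≥0∞ => (if p.1 = x then 0 else 1) * g p :=
    (Measurable.ite (measurable_fst (measurableSet_singleton x)) measurable_const
      measurable_const).mul hg
  have hf : Measurable fun h : ((_i : Finset.Iic n) → S × ℝ≥0∞) =>
      ∏ j : Finset.Iic n, if (j : ℕ) ≠ 0 ∧ (h j).1 = x then (0 : ℝ≥0∞) else 1 := by
    refine Finset.measurable_prod _ fun j _ => Measurable.ite ?_ measurable_const measurable_const
    exact (MeasurableSet.const _).inter
      ((measurable_fst.comp (measurable_pi_apply j)) (measurableSet_singleton x))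
  have hfr : ∀ ω : ℕ → S × ℝ≥0∞, (∏ j : Finset.Iic n, if (j : ℕ) ≠ 0 ∧
      (Preorder.frestrictLe (π := fun _ => S × ℝ≥0∞) n ω j).1 = x then (0 : ℝ≥0∞) else 1) =
      noVisit x n ω := fun ω =>
    Finset.prod_coe_sort (Finset.Iic n) fun j => if j ≠ 0 ∧ (ω j).1 = x then (0 : ℝ≥0∞) else 1
  have h1 := R.lintegral_law_succ x n hf hg'
  simp only [hfr] at h1
  simp only [noVisit_succ, mul_assoc]
  rw [h1]
  refine lintegral_mono fun ω => mul_le_mul' le_rfl ?_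
  rw [R.lintegral_stepKernel _ hg']
  refine ENNReal.tsum_le_tsum fun y => mul_le_mul' le_rfl ?_
  by_cases hy : y = x
  · simp [hy]
  · simpa [hy] using hW y hy

/-- Foster's criterion with a single target state `x`. If `W` decreases in the mean by at least
the mean holding time plus `1` over each jump out of a state other than `x`, and has a finite
mean after a jump out of `x`, then `x` is positive recurrent. -/
theorem positiveRecurrent_of_drift (x : S) (W : S → ℝ≥0∞) (hx : R.exitRate x ≠ 0)
    (hW : ∀ z ≠ x, (R.exitRate z : ℝ≥0∞)⁻¹ + 1 + ∑' y, R.jumpLaw z y * W y ≤ W z)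
    (hWx : ∑' y, R.jumpLaw x y * W y ≠ ⊤) : R.PositiveRecurrent x := by
  right
  set PW : S → ℝ≥0∞ := fun z => ∑' y, R.jumpLaw z y * W y with hPW
  have hmPW : Measurable PW := measurable_of_countable _
  have hm : ∀ n, Measurable fun ω : ℕ → S × ℝ≥0∞ => noVisit x n ω * ((ω n).2 + 1) := fun n =>
    (measurable_noVisit x n).mul (by fun_prop)
  set a : ℕ → ℝ≥0∞ := fun n => ∫⁻ ω, noVisit x n ω * ((ω n).2 + 1) ∂(R.law x) with ha
  set b : ℕ → ℝ≥0∞ := fun n => ∫⁻ ω, noVisit x n ω * PW (ω n).1 ∂(R.law x) with hb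
  have hstep : ∀ n, a (n + 1) + b (n + 1) ≤ b n := fun n => by
    -- Over the holding time in `y` this has the mean `1 / exitRate y + 1 + PW y ≤ W y`.
    have hg : Measurable fun p : S × ℝ≥0∞ => p.2 + 1 + PW p.1 := by fun_prop
    have h1 := R.lintegral_noVisit_succ x n hg (W := W) fun y hy => by
      simp only
      rw [lintegral_add_right _ measurable_const, lintegral_add_right _ measurable_const,
        R.lintegral_holdLaw]
      simpa using hW y hy
    simp only [mul_add _ _ (PW _)] at h1
    rwa [lintegral_add_left (hm (n + 1))] at h1
  have hsum : ∀ n, ∑ i ∈ Finset.range n, a (i + 1) + b n ≤ b 0 := fun n => by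
    induction n with
    | zero => simp
    | succ n ih =>
      rw [Finset.sum_range_succ, add_assoc]
      exact (add_le_add le_rfl (hstep n)).trans ih
  have ha0 : a 0 = (R.exitRate x : ℝ≥0∞)⁻¹ + 1 := by
    have h1 := R.lintegral_law_zero x (g := fun p => p.2 + 1) (by fun_prop)
    simp only [ha, noVisit_zero, one_mul]
    rw [h1, lintegral_add_right _ measurable_const, R.lintegral_holdLaw]
    simp
  have hb0 : b 0 = PW x := by
    have h1 := R.lintegral_law_zero x (g := fun p => PW p.1) (by fun_prop)
    simp only [hb, noVisit_zero, one_mul]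
    rw [h1]
    simp
  calc ∫⁻ ω, returnTime x ω ∂(R.law x)
      ≤ ∫⁻ ω, ∑' n, noVisit x n ω * ((ω n).2 + 1) ∂(R.law x) := by
        refine lintegral_mono_ae ?_
        filter_upwards [R.ae_holdingTime_ne x R.holdLaw_zero] with ω hω
        exact returnTime_le_tsum x hω
    _ = ∑' n, a n := lintegral_tsum fun n => (hm n).aemeasurable
    _ = a 0 + ∑' n, a (n + 1) := tsum_eq_zero_add' ENNReal.summable
    _ ≤ a 0 + b 0 := by
        gcongr
        exact ENNReal.tsum_le_of_sum_range_le fun n => le_self_add.trans (hsum n)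
    _ < ⊤ := by
        rw [ha0, hb0]
        simp [hx, hWx, lt_top_iff_ne_top, hPW]

end Generic
end TransitionRates

namespace TransitionRates

/-! ### The Foster–Lyapunov criterion -/

section Generic

variable {S : Type*} (R : TransitionRates S)

/-- If `x` can be reached from everywhere, the number of steps needed to reach it is a function
that some possible jump decreases, in every state other than `x`. -/
theorem exists_rank {x : S}
    (h : ∀ z, Relation.ReflTransGen (fun a b => 0 < R.q a b) z x) :
    ∃ d : S → ℕ, ∀ z ≠ x, ∃ z', 0 < R.q z z' ∧ d z' < d z := by
  classical
  have hA : ∀ z, ∃ n, ∃ l : List S, l.length = n ∧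
      List.IsChain (fun a b => 0 < R.q a b) (z :: l) ∧ (z :: l).getLast (by simp) = x := by
    intro z
    obtain ⟨l, hl, hx⟩ := List.exists_isChain_cons_of_relationReflTransGen (h z)
    exact ⟨_, l, rfl, hl, hx⟩
  refine ⟨fun z => Nat.find (hA z), fun z hz => ?_⟩
  obtain ⟨l, hn, hl, hx⟩ := Nat.find_spec (hA z)
  cases l with
  | nil => exact absurd (by simpa using hx) hz
  | cons z' l =>
    rw [List.isChain_cons_cons] at hl
    refine ⟨z', hl.1, ?_⟩
    have h2 : Nat.find (hA z') ≤ l.length :=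
      Nat.find_min' _ ⟨l, rfl, hl.2, by simpa [List.getLast_cons] using hx⟩
    exact (Nat.lt_succ_of_le h2).trans_eq hn

/-- A bounded function that decreases in the mean everywhere except at `x`: with `d` as in
`exists_rank` and `ε` small, `1 - ε ^ d` has this property, because the gain from the one jump
that decreases `d` outweighs the loss from all the others. -/
theorem exists_bounded_drift {x : S} {m M : ℝ≥0} (hm : 0 < m)
    (hqm : ∀ a b, 0 < R.q a b → m ≤ R.q a b) (hM : ∀ z, R.exitRate z ≤ M)
    (h : ∀ z, Relation.ReflTransGen (fun a b => 0 < R.q a b) z x) :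
    ∃ u η : S → ℝ≥0, (∀ z, u z ≤ 1) ∧ (∀ z, 0 < η z) ∧
      ∀ z ≠ x, ∑' y, (R.q z y : ℝ≥0∞) * u y + η z ≤ R.exitRate z * u z := by
  obtain ⟨d, hd⟩ := R.exists_rank h
  obtain ⟨ε, hε, hε1, hεM⟩ : ∃ ε : ℝ≥0, 0 < ε ∧ ε ≤ 1 ∧ (M + m) * ε ≤ m := by
    refine ⟨m / (M + m), by positivity, div_le_one_of_le₀ le_add_self (by positivity), ?_⟩
    rw [mul_div_cancel₀ _ (by positivity)]
  have hpow : ∀ k, ε ^ k ≤ 1 := fun k => pow_le_one₀ zero_le hε1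
  refine ⟨fun z => 1 - ε ^ d z, fun z => m * ε ^ d z, fun z => tsub_le_self,
    fun z => by positivity, fun z hz => ?_⟩
  have hu : ∀ z, ((1 - ε ^ d z : ℝ≥0) : ℝ≥0∞) + (ε ^ d z : ℝ≥0) = 1 := fun z => by
    rw [← ENNReal.coe_add, tsub_add_cancel_of_le (hpow _), ENNReal.coe_one]
  obtain ⟨z', hz', hdz⟩ := hd z hz
  have h1 : ∑' y, (R.q z y : ℝ≥0∞) * (1 - ε ^ d y : ℝ≥0) +
      ∑' y, (R.q z y : ℝ≥0∞) * (ε ^ d y : ℝ≥0) = R.exitRate z := by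
    rw [← ENNReal.tsum_add, ← R.tsum_coe]
    exact tsum_congr fun y => by rw [← mul_add, hu, mul_one]
  have h2 : (R.exitRate z : ℝ≥0∞) * (1 - ε ^ d z : ℝ≥0) + R.exitRate z * (ε ^ d z : ℝ≥0) =
      R.exitRate z := by rw [← mul_add, hu, mul_one]
  have h3 : m * ε ^ d z + R.exitRate z * ε ^ d z ≤ R.q z z' * ε ^ d z' := by
    calc m * ε ^ d z + R.exitRate z * ε ^ d z ≤ m * ε ^ d z + M * ε ^ d z := by
          gcongr
          exact hM z
      _ = (M + m) * ε ^ d z := by ring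
      _ ≤ (M + m) * ε ^ (d z' + 1) := by
          gcongr (M + m) * ?_
          exact pow_le_pow_of_le_one zero_le hε1 hdz
      _ = (M + m) * ε * ε ^ d z' := by ring
      _ ≤ m * ε ^ d z' := by gcongr
      _ ≤ R.q z z' * ε ^ d z' := by
          gcongr
          exact hqm z z' hz'
  have h4 : ((m * ε ^ d z : ℝ≥0) : ℝ≥0∞) + R.exitRate z * (ε ^ d z : ℝ≥0) ≤
      ∑' y, (R.q z y : ℝ≥0∞) * (ε ^ d y : ℝ≥0) :=
    (by exact_mod_cast h3 : ((m * ε ^ d z : ℝ≥0) : ℝ≥0∞) + R.exitRate z * (ε ^ d z : ℝ≥0) ≤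
      R.q z z' * (ε ^ d z' : ℝ≥0)).trans (ENNReal.le_tsum z')
  have hfin : (R.exitRate z : ℝ≥0∞) * (ε ^ d z : ℝ≥0) ≠ ⊤ := by
    rw [← ENNReal.coe_mul]
    exact ENNReal.coe_ne_top
  rw [← ENNReal.add_le_add_iff_right hfin, h2, add_assoc]
  exact (add_le_add le_rfl h4).trans h1.le

variable [MeasurableSpace S] [MeasurableSingletonClass S] [Countable S]

/-- `positiveRecurrent_of_drift` in terms of the rates. -/
theorem positiveRecurrent_of_rate_drift {x : S} {M : ℝ≥0} (hM : ∀ z, R.exitRate z ≤ M)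
    (hexit : ∀ z, R.exitRate z ≠ 0) (W : S → ℝ≥0)
    (hW : ∀ z ≠ x, ∑' y, (R.q z y : ℝ≥0∞) * W y + (1 + M) ≤ R.exitRate z * W z)
    (hWx : ∑' y, (R.q x y : ℝ≥0∞) * W y ≠ ⊤) : R.PositiveRecurrent x := by
  have hmean : ∀ z, ∑' y, R.jumpLaw z y * W y =
      (R.exitRate z : ℝ≥0∞)⁻¹ * ∑' y, (R.q z y : ℝ≥0∞) * W y := fun z => by
    rw [← ENNReal.tsum_mul_left]
    refine tsum_congr fun y => ?_
    rw [R.jumpLaw_apply (hexit z)]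
    ring
  refine R.positiveRecurrent_of_drift x (fun z => W z) (hexit x) (fun z hz => ?_) ?_
  · have h0 : (R.exitRate z : ℝ≥0∞) ≠ 0 := by exact_mod_cast hexit z
    have h1 : (R.exitRate z : ℝ≥0∞)⁻¹ * R.exitRate z = 1 :=
      ENNReal.inv_mul_cancel h0 ENNReal.coe_ne_top
    rw [hmean]
    calc (R.exitRate z : ℝ≥0∞)⁻¹ + 1 +
          (R.exitRate z : ℝ≥0∞)⁻¹ * ∑' y, (R.q z y : ℝ≥0∞) * W y
        = (R.exitRate z : ℝ≥0∞)⁻¹ *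
          (∑' y, (R.q z y : ℝ≥0∞) * W y + (1 + R.exitRate z)) := by
          rw [mul_add, mul_add, h1, mul_one, add_comm]
      _ ≤ (R.exitRate z : ℝ≥0∞)⁻¹ * (R.exitRate z * W z) := by
          gcongr
          refine le_trans ?_ (hW z hz)
          gcongr
          exact hM z
      _ = W z := by rw [← mul_assoc, h1, one_mul]
  · rw [hmean]
    exact ENNReal.mul_ne_top (by simpa using hexit x) hWx

/-- The Foster–Lyapunov criterion: let `x` be reachable from everywhere and the positive rates
be bounded away from `0` and `∞`. If the drift of `V ≥ 0` is bounded above, and at most `-δ < 0`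
off a finite set `F`, then `x` is positive recurrent. A large multiple of the function from
`exists_bounded_drift`, added to a multiple of `V`, has a negative drift also on `F \ {x}`. -/
theorem positiveRecurrent_of_lyapunov {x : S} {m M : ℝ≥0} (hm : 0 < m)
    (hqm : ∀ a b, 0 < R.q a b → m ≤ R.q a b) (hM : ∀ z, R.exitRate z ≤ M)
    (hexit : ∀ z, R.exitRate z ≠ 0)
    (h : ∀ z, Relation.ReflTransGen (fun a b => 0 < R.q a b) z x)
    (V : S → ℝ≥0) {F : Set S} (hF : F.Finite) {δ C : ℝ≥0} (hδ : 0 < δ)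
    (hVF : ∀ z ∉ F, ∑' y, (R.q z y : ℝ≥0∞) * V y + δ ≤ R.exitRate z * V z)
    (hV : ∀ z, ∑' y, (R.q z y : ℝ≥0∞) * V y ≤ R.exitRate z * V z + C) :
    R.PositiveRecurrent x := by
  obtain ⟨u, η, hu, hη, hdrift⟩ := R.exists_bounded_drift hm hqm hM h
  obtain ⟨η₀, hη₀, hηF⟩ : ∃ η₀, 0 < η₀ ∧ ∀ z ∈ F, η₀ ≤ η z := by
    rcases F.eq_empty_or_nonempty with rfl | hne
    · exact ⟨1, one_pos, by simp⟩
    · obtain ⟨a, -, ha⟩ := hF.exists_minimalFor η F hne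
      exact ⟨η a, hη a, fun z hz => (le_total (η a) (η z)).elim id (ha hz)⟩
  -- `A` makes the drift of `A V` at most `-(1 + M)` off `F`; on `F` it is at most `A C`, which
  -- `B` compensates.
  set A : ℝ≥0 := (1 + M) / δ with hA
  set B : ℝ≥0 := (A * C + (1 + M)) / η₀ with hB
  have hAδ : A * δ = 1 + M := div_mul_cancel₀ _ hδ.ne'
  have hBη : B * η₀ = A * C + (1 + M) := div_mul_cancel₀ _ hη₀.ne'
  have hsum : ∀ z, ∑' y, (R.q z y : ℝ≥0∞) * (A * V y + B * u y : ℝ≥0) =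
      A * ∑' y, (R.q z y : ℝ≥0∞) * V y + B * ∑' y, (R.q z y : ℝ≥0∞) * u y := fun z => by
    rw [← ENNReal.tsum_mul_left, ← ENNReal.tsum_mul_left, ← ENNReal.tsum_add]
    refine tsum_congr fun y => ?_
    push_cast
    ring
  refine R.positiveRecurrent_of_rate_drift hM hexit (fun z => A * V z + B * u z)
    (fun z hz => ?_) ?_
  · rw [hsum]
    by_cases hzF : z ∈ F
    · have hC : (A * C : ℝ≥0∞) ≠ ⊤ := by
        rw [← ENNReal.coe_mul]
        exact ENNReal.coe_ne_top
      rw [← ENNReal.add_le_add_iff_right hC]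
      calc (A : ℝ≥0∞) * ∑' y, (R.q z y : ℝ≥0∞) * V y + B * ∑' y, (R.q z y : ℝ≥0∞) * u y +
            (1 + M) + A * C
          = A * ∑' y, (R.q z y : ℝ≥0∞) * V y +
            (B * ∑' y, (R.q z y : ℝ≥0∞) * u y + (B * η₀ : ℝ≥0)) := by
            rw [hBη]
            push_cast
            ring
        _ ≤ A * (R.exitRate z * V z + C) +
            B * (∑' y, (R.q z y : ℝ≥0∞) * u y + η z) := by
            rw [ENNReal.coe_mul, ← mul_add]
            gcongr
            · exact hV z
            · exact hηF z hzF
        _ ≤ A * (R.exitRate z * V z + C) + B * (R.exitRate z * u z) := by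
            gcongr
            exact hdrift z hz
        _ = _ := by
            push_cast
            ring
    · calc (A : ℝ≥0∞) * ∑' y, (R.q z y : ℝ≥0∞) * V y +
            B * ∑' y, (R.q z y : ℝ≥0∞) * u y + (1 + M)
          = A * (∑' y, (R.q z y : ℝ≥0∞) * V y + δ) + B * ∑' y, (R.q z y : ℝ≥0∞) * u y := by
            rw [mul_add, ← ENNReal.coe_mul A δ, hAδ]
            push_cast
            ring
        _ ≤ A * (R.exitRate z * V z) + B * (R.exitRate z * u z) := by
            gcongr
            · exact hVF z hzF
            · exact le_self_add.trans (hdrift z hz)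
        _ = _ := by
            push_cast
            ring
  · rw [hsum]
    have h1 : ∑' y, (R.q x y : ℝ≥0∞) * V y ≠ ⊤ := by
      refine ne_top_of_le_ne_top ?_ (hV x)
      exact_mod_cast ENNReal.coe_ne_top (r := R.exitRate x * V x + C)
    have h2 : ∑' y, (R.q x y : ℝ≥0∞) * u y ≠ ⊤ := by
      refine ne_top_of_le_ne_top (ENNReal.coe_ne_top (r := R.exitRate x)) ?_
      rw [← R.tsum_coe]
      exact ENNReal.tsum_le_tsum fun y => mul_le_of_le_one_right' (by exact_mod_cast hu y)
    exact ENNReal.add_ne_top.2 ⟨ENNReal.mul_ne_top ENNReal.coe_ne_top h1,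
      ENNReal.mul_ne_top ENNReal.coe_ne_top h2⟩

end Generic
end TransitionRates

namespace JFFC

variable {K : ℕ} {c : Fin K → ℕ}

/-! ### Reachability of the states -/

/-- The state with `n` queued jobs and all chains fully occupied. -/
def State.full (c : Fin K → ℕ) (n : ℕ) : State c :=
  ⟨(n, c), n.eq_zero_or_pos.imp (fun h => ⟨h, fun _ => le_rfl⟩) fun h => ⟨h, rfl⟩⟩

theorem State.queue_full (n : ℕ) : (State.full c n).queue = n := rfl

theorem State.jobs_le (z : State c) (l : Fin K) : z.jobs l ≤ c l :=
  z.2.elim (fun h => h.2 l) fun h => (congrFun h.2 l).le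

theorem State.eq_full_of_jobs_eq {z : State c} (h : z.jobs = c) : z = State.full c z.queue :=
  State.ext rfl h

theorem State.jobs_eq_of_queue_pos {z : State c} (h : 0 < z.queue) : z.jobs = c :=
  z.2.elim (fun h' => absurd h'.1 h.ne') fun h' => h'.2

/-- The state with an empty queue and one more job on the chain `l` than in `z`. -/
def State.addJob (z : State c) (l : Fin K) (h : z.jobs l < c l) : State c :=
  ⟨(0, Function.update z.jobs l (z.jobs l + 1)), Or.inl ⟨rfl, fun i => by
    by_cases hi : i = l
    · subst hi
      simpa using h
    · simpa [hi] using z.jobs_le i⟩⟩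

theorem State.queue_eq_zero_of_lt {z : State c} {l : Fin K} (h : z.jobs l < c l) :
    z.queue = 0 := by
  by_contra h0
  rw [State.jobs_eq_of_queue_pos (Nat.pos_of_ne_zero h0)] at h
  exact h.false

theorem State.jobs_addJob_self (z : State c) (l : Fin K) (h : z.jobs l < c l) :
    (z.addJob l h).jobs l = z.jobs l + 1 :=
  Function.update_self _ _ _

theorem State.jobs_addJob_of_ne (z : State c) {l : Fin K} (h : z.jobs l < c l) {i : Fin K}
    (hi : i ≠ l) : (z.addJob l h).jobs i = z.jobs i :=
  Function.update_of_ne hi _ _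

/-- The number of free places. -/
def State.free (z : State c) : ℕ := ∑ l, (c l - z.jobs l)

theorem State.free_addJob_lt (z : State c) (l : Fin K) (h : z.jobs l < c l) :
    (z.addJob l h).free < z.free := by
  refine Finset.sum_lt_sum (fun i _ => ?_) ⟨l, Finset.mem_univ l, ?_⟩
  · by_cases hi : i = l
    · subst hi
      rw [z.jobs_addJob_self]
      omega
    · rw [z.jobs_addJob_of_ne h hi]
  · rw [z.jobs_addJob_self]
    omega

theorem State.exists_jobs_lt {z : State c} (h : z.jobs ≠ c) : ∃ l, z.jobs l < c l := by
  obtain ⟨l, hl⟩ := Function.ne_iff.1 h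
  exact ⟨l, lt_of_le_of_ne (z.jobs_le l) hl⟩

theorem isDeparture_addJob (z : State c) (l : Fin K) (h : z.jobs l < c l) :
    IsDeparture l (z.addJob l h) z :=
  ⟨rfl, State.queue_eq_zero_of_lt h, (z.jobs_addJob_self l h).symm,
    fun _ hi => (z.jobs_addJob_of_ne h hi).symm⟩

theorem exists_isArrival_addJob {z : State c} (h : z.jobs ≠ c) :
    ∃ (l : Fin K) (hl : z.jobs l < c l), IsArrival z (z.addJob l hl) := by
  have hne : (Finset.univ.filter fun l => z.jobs l < c l).Nonempty := by
    obtain ⟨l, hl⟩ := State.exists_jobs_lt h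
    exact ⟨l, by simpa using hl⟩
  have hmem := Finset.min'_mem _ hne
  simp only [Finset.mem_filter, Finset.mem_univ, true_and] at hmem
  refine ⟨_, hmem, Or.inr ⟨_, ⟨hmem, fun l' hl' hlt => ?_⟩, z.jobs_addJob_self _ _,
    fun i hi => z.jobs_addJob_of_ne _ hi, (State.queue_eq_zero_of_lt hmem).symm⟩⟩
  exact (Finset.min'_le _ l' (by simpa using hlt)).not_gt hl'

theorem isArrival_full (n : ℕ) : IsArrival (State.full c n) (State.full c (n + 1)) :=
  Or.inl ⟨rfl, rfl, rfl⟩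

theorem isQueueDeparture_full (n : ℕ) :
    IsQueueDeparture (State.full c (n + 1)) (State.full c n) := ⟨rfl, rfl, rfl⟩

variable {lam : ℝ≥0} {mu : Fin K → ℝ≥0}

theorem le_rate_of_isArrival {z z' : State c} (h : IsArrival z z') : lam ≤ rate lam mu z z' := by
  rw [rate, if_pos h, add_assoc]
  exact le_self_add

theorem le_rate_of_isDeparture {l : Fin K} {z z' : State c} (h : IsDeparture l z z') :
    mu l ≤ rate lam mu z z' := by
  classical
  have h1 : 1 ≤ (z.jobs l : ℝ≥0) := by
    have := h.2.2.1
    exact_mod_cast (by omega : 1 ≤ z.jobs l)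
  calc mu l ≤ (z.jobs l : ℝ≥0) * mu l := le_mul_of_one_le_left' h1
    _ = if IsDeparture l z z' then (z.jobs l : ℝ≥0) * mu l else 0 := (if_pos h).symm
    _ ≤ ∑ l, if IsDeparture l z z' then (z.jobs l : ℝ≥0) * mu l else 0 :=
      Finset.single_le_sum (f := fun l => if IsDeparture l z z' then (z.jobs l : ℝ≥0) * mu l else 0)
        (fun _ _ => zero_le) (Finset.mem_univ l)
    _ ≤ _ := by
      rw [rate, add_right_comm]
      refine le_trans (le_of_eq ?_) le_add_self
      congr!

theorem le_rate_of_isQueueDeparture {z z' : State c} (h : IsQueueDeparture z z') :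
    ∑ l, (c l : ℝ≥0) * mu l ≤ rate lam mu z z' := by
  rw [rate, if_pos h]
  exact le_add_self

/-- A positive rate belongs to an arrival or to one of the two kinds of departures. -/
theorem cases_of_rate_pos {z z' : State c} (h : 0 < rate lam mu z z') :
    IsArrival z z' ∨ (∃ l, IsDeparture l z z') ∨ IsQueueDeparture z z' := by
  by_contra! hcon
  obtain ⟨h1, h2, h3⟩ := hcon
  simp [rate, h1, h2, h3] at h

/-- From any state the system can fill up: arrivals occupy the free places, departures empty the
queue. -/
theorem reflTransGen_full (hlam : 0 < lam) (hstable : lam < ∑ l, (c l : ℝ≥0) * mu l)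
    (z : State c) :
    Relation.ReflTransGen (fun a b : State c => 0 < rate lam mu a b) z (State.full c 0) := by
  by_cases h : z.jobs = c
  · rw [State.eq_full_of_jobs_eq h]
    induction z.queue with
    | zero => exact .refl
    | succ n ih =>
      exact .head ((hlam.trans hstable).trans_le
        (le_rate_of_isQueueDeparture (isQueueDeparture_full n))) ih
  · obtain ⟨l, hl, ha⟩ := exists_isArrival_addJob h
    exact .head (hlam.trans_le (le_rate_of_isArrival ha))
      (reflTransGen_full hlam hstable (z.addJob l hl))
termination_by z.free
decreasing_by exact z.free_addJob_lt l hl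

/-- From the fully occupied system without a queue every state can be reached: arrivals build up
a queue, and departures free any places. -/
theorem reflTransGen_of_full (hmu : ∀ l, 0 < mu l) (hlam : 0 < lam) (z : State c) :
    Relation.ReflTransGen (fun a b : State c => 0 < rate lam mu a b) (State.full c 0) z := by
  by_cases h : z.jobs = c
  · rw [State.eq_full_of_jobs_eq h]
    induction z.queue with
    | zero => exact .refl
    | succ n ih => exact .tail ih (hlam.trans_le (le_rate_of_isArrival (isArrival_full n)))
  · obtain ⟨l, hl⟩ := State.exists_jobs_lt h
    exact .tail (reflTransGen_of_full hmu hlam (z.addJob l hl))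
      ((hmu l).trans_le (le_rate_of_isDeparture (isDeparture_addJob z l hl)))
termination_by z.free
decreasing_by exact z.free_addJob_lt l hl

/-! ### Bounds on the rates and the drift of the queue length -/

theorem exists_isArrival (z : State c) : ∃ z', IsArrival z z' := by
  by_cases h : z.jobs = c
  · rw [State.eq_full_of_jobs_eq h]
    exact ⟨_, isArrival_full _⟩
  · obtain ⟨l, hl, ha⟩ := exists_isArrival_addJob h
    exact ⟨_, ha⟩

theorem exitRate_ne_zero (hlam : 0 < lam) (z : State c) : (rates lam mu c).exitRate z ≠ 0 := by
  obtain ⟨z', h⟩ := exists_isArrival z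
  have h1 : rate lam mu z z' ≤ (rates lam mu c).exitRate z :=
    ((rates lam mu c).summable_q z).le_tsum z' fun _ _ => zero_le
  exact (hlam.trans_le ((le_rate_of_isArrival h).trans h1)).ne'

theorem exists_le_rate (hmu : ∀ l, 0 < mu l) (hlam : 0 < lam)
    (hstable : lam < ∑ l, (c l : ℝ≥0) * mu l) :
    ∃ m > 0, ∀ z z' : State c, 0 < rate lam mu z z' → m ≤ rate lam mu z z' := by
  obtain ⟨i, hi⟩ := Finite.exists_min fun o : Option (Fin K) => o.elim lam mu
  refine ⟨i.elim lam mu, ?_, fun z z' h => ?_⟩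
  · cases i
    exacts [hlam, hmu _]
  · rcases cases_of_rate_pos h with h | ⟨l, h⟩ | h
    · exact (hi none).trans (le_rate_of_isArrival h)
    · exact (hi (some l)).trans (le_rate_of_isDeparture h)
    · exact (hi none).trans (hstable.le.trans (le_rate_of_isQueueDeparture h))

open Classical in
theorem tsum_ite_le {α : Type*} {p : α → Prop} (a : ℝ≥0∞) (h : ∀ x y, p x → p y → x = y) :
    ∑' x, (if p x then a else 0) ≤ a := by
  by_cases hp : ∃ x, p x
  · obtain ⟨x, hx⟩ := hp
    rw [tsum_eq_single x fun y hy => if_neg fun hpy => hy (h y x hpy hx), if_pos hx]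
  · push Not at hp
    simp [hp]

theorem exitRate_le (z : State c) : (rates lam mu c).exitRate z ≤
    lam + ∑ l, (c l : ℝ≥0) * mu l + ∑ l, (c l : ℝ≥0) * mu l := by
  classical
  rw [← ENNReal.coe_le_coe, ← TransitionRates.tsum_coe]
  change ∑' y, (rate lam mu z y : ℝ≥0∞) ≤ _
  simp only [rate, ENNReal.coe_add, ENNReal.ofNNReal_finsetSum, ENNReal.tsum_add]
  rw [Summable.tsum_finsetSum fun _ _ => ENNReal.summable]
  simp only [apply_ite ENNReal.ofNNReal, ENNReal.coe_zero]
  gcongr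
  · exact tsum_ite_le _ fun _ _ => IsArrival.unique
  · refine (tsum_ite_le _ fun _ _ => IsDeparture.unique).trans ?_
    have := z.jobs_le
    gcongr
    exact this _
  · refine (tsum_ite_le _ fun _ _ => IsQueueDeparture.unique).trans ?_
    rw [ENNReal.ofNNReal_finsetSum]

open Classical in
/-- With a nonempty queue the queue length is a birth-and-death chain. -/
theorem tsum_rate_full_succ (n : ℕ) (g : State c → ℝ≥0∞) :
    ∑' y, (rate lam mu (State.full c (n + 1)) y : ℝ≥0∞) * g y =
      lam * g (State.full c (n + 2)) +
        ((∑ l, (c l : ℝ≥0) * mu l : ℝ≥0) : ℝ≥0∞) * g (State.full c n) := by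
  have h1 : ∀ y, IsArrival (State.full c (n + 1)) y ↔ y = State.full c (n + 2) := fun y =>
    ⟨fun h => h.unique (isArrival_full _), fun h => h ▸ isArrival_full _⟩
  have h2 : ∀ l y, ¬ IsDeparture l (State.full c (n + 1)) y := fun l y h =>
    absurd h.1 (Nat.succ_ne_zero n)
  have h3 : ∀ y, IsQueueDeparture (State.full c (n + 1)) y ↔ y = State.full c n := fun y =>
    ⟨fun h => h.unique (isQueueDeparture_full _), fun h => h ▸ isQueueDeparture_full _⟩
  simp only [rate, h1, h2, h3, if_false, Finset.sum_const_zero, add_zero, ENNReal.coe_add, add_mul,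
    ENNReal.tsum_add]
  congr 1
  · rw [tsum_eq_single (State.full c (n + 2)) fun y hy => by simp [hy], if_pos rfl]
  · rw [tsum_eq_single (State.full c n) fun y hy => by simp [hy], if_pos rfl]

theorem queue_drift_full_succ (hstable : lam < ∑ l, (c l : ℝ≥0) * mu l) (n : ℕ) :
    ∑' y, ((rates lam mu c).q (State.full c (n + 1)) y : ℝ≥0∞) * ((y.queue : ℝ≥0) : ℝ≥0∞) +
      ((∑ l, (c l : ℝ≥0) * mu l - lam : ℝ≥0) : ℝ≥0∞) =
    (rates lam mu c).exitRate (State.full c (n + 1)) *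
      (((State.full c (n + 1)).queue : ℝ≥0) : ℝ≥0∞) := by
  have hexit := tsum_rate_full_succ (lam := lam) (mu := mu) (c := c) n fun _ => 1
  simp only [mul_one] at hexit
  rw [← TransitionRates.tsum_coe]
  change ∑' y, (rate lam mu (State.full c (n + 1)) y : ℝ≥0∞) * ((y.queue : ℝ≥0) : ℝ≥0∞) + _ =
    (∑' y, (rate lam mu (State.full c (n + 1)) y : ℝ≥0∞)) * _
  rw [tsum_rate_full_succ n fun y => ((y.queue : ℝ≥0) : ℝ≥0∞), hexit]
  simp only [State.queue_full]
  obtain ⟨δ, hδ⟩ := exists_add_of_le hstable.le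
  rw [hδ, add_tsub_cancel_left]
  push_cast
  ring

/-- In every state the queue grows by at most `1` upon a jump. -/
theorem queue_drift_le (z : State c) :
    ∑' y, ((rates lam mu c).q z y : ℝ≥0∞) * ((y.queue : ℝ≥0) : ℝ≥0∞) ≤
      (rates lam mu c).exitRate z * ((z.queue : ℝ≥0) : ℝ≥0∞) + (rates lam mu c).exitRate z := by
  rw [← mul_add_one, ← TransitionRates.tsum_coe, ← ENNReal.tsum_mul_right]
  refine ENNReal.tsum_le_tsum fun y => ?_
  rcases eq_zero_or_pos ((rates lam mu c).q z y) with h | h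
  · simp [h]
  · have hq : y.queue ≤ z.queue + 1 := by
      rcases cases_of_rate_pos h with (⟨-, h, -⟩ | ⟨-, -, -, -, h⟩) | ⟨-, -, h, -⟩ | ⟨h, -⟩ <;>
        omega
    gcongr
    exact_mod_cast hq

theorem finite_queue_eq_zero (c : Fin K → ℕ) : {z : State c | z.queue = 0}.Finite := by
  refine Set.Finite.of_finite_image (f := State.jobs) ((Set.finite_Iic c).subset ?_) ?_
  · rintro _ ⟨z, -, rfl⟩
    exact z.jobs_le
  · exact fun z hz w hw h => State.ext (hz.trans hw.symm) h

end JFFC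

theorem mainTheorem6 (K : ℕ) (c : Fin K → ℕ) (mu : Fin K → ℝ≥0) (lam : ℝ≥0)
    (hmu : ∀ l, 0 < mu l) (hsorted : Antitone mu) (hlam : 0 < lam)
    (hstable : lam < ∑ l, (c l : ℝ≥0) * mu l) :
    (JFFC.rates lam mu c).Ergodic := by
  have hreach : ∀ x y : JFFC.State c,
      Relation.ReflTransGen (fun a b => 0 < (JFFC.rates lam mu c).q a b) x y := fun x y =>
    (JFFC.reflTransGen_full hlam hstable x).trans (JFFC.reflTransGen_of_full hmu hlam y)
  refine ⟨TransitionRates.irreducible_of_reflTransGen _ (JFFC.exitRate_ne_zero hlam) hreach,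
    fun x => ?_⟩
  obtain ⟨m, hm, hqm⟩ := JFFC.exists_le_rate hmu hlam hstable
  refine TransitionRates.positiveRecurrent_of_lyapunov _ hm hqm JFFC.exitRate_le
    (JFFC.exitRate_ne_zero hlam) (fun z => hreach z x) (fun z => z.queue)
    (JFFC.finite_queue_eq_zero c)
    (C := lam + ∑ l, (c l : ℝ≥0) * mu l + ∑ l, (c l : ℝ≥0) * mu l) (tsub_pos_of_lt hstable)
    (fun z hz => ?_) fun z => (JFFC.queue_drift_le z).trans ?_
  · have hz' := JFFC.State.eq_full_of_jobs_eq
      (JFFC.State.jobs_eq_of_queue_pos (Nat.pos_of_ne_zero hz))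
    obtain ⟨n, hn⟩ := Nat.exists_eq_succ_of_ne_zero hz
    rw [hz', hn]
    exact (JFFC.queue_drift_full_succ hstable n).le
  · gcongr
    exact JFFC.exitRate_le z
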